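/- Let $f$ be a meromorphic function on $\mathbb{C}$, not identically zero, whose order of growth $$\sigma=\sigma(f)=\limsup_{r\to\infty}\frac{\log^{+}T(r,f)}{\log r}$$ satisfies $\sigma<1$, where $T(r,f)$ is the Nevanlinna characteristic of $f$. Let $\eta\in\mathbb{C}$ be a fixed non-zero number, and write $\Delta f(z)=f(z+\eta)-f(z)$ and $\Delta^{k}f=\Delta(\Delta^{k-1}f)$, with $\Delta^0f=f$. Then for every $\varepsilon>0$ and every integer $k\ge 0$ there is a set $E\subset(1,\infty)$ of finite logarithmic measure, i.e. $\int_E \frac{dt}{t}<\infty$, such that for all $z\in\mathbb{C}$ with $|z|=r\notin E\cup[0,1]$ we have $f(z)\neq 0$, $f$ is analytic at $z, z+\eta,\dots,z+k\eta$, and $$\frac{\Delta^{k}f(z)}{f(z)}=\eta^{k}\,\frac{f^{(k)}(z)}{f(z)}+O\!\left(r^{(k+1)(\sigma-1)+\varepsilon}\right),$$ where the implied constant does not depend on $z$ (it may depend on $f$, $\eta$, $k$, $\varepsilon$). -/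

import Mathlib

/-- The order of growth `σ(f) = limsup_{r → ∞} log⁺ T(r, f) / log r` of a meromorphic function `f`
on the complex plane, where `T(r, f) = m(r, f) + N(r, f)` is the Nevanlinna characteristic
(`ValueDistribution.characteristic f ⊤`). It is an extended real number. -/
noncomputable def nevanlinnaOrder (f : ℂ → ℂ) : EReal :=
  Filter.limsup
    (fun r : ℝ => ((Real.posLog (ValueDistribution.characteristic f ⊤ r) / Real.log r : ℝ) : EReal))
    Filter.atTop

/-- A (measurable) set `E` of positive reals has finite logarithmic measure if
`∫_E dt / t < ∞`. -/
def HasFiniteLogMeasure (E : Set ℝ) : Prop :=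
  MeasurableSet E ∧ ∫⁻ t in E, ENNReal.ofReal (1 / t) < ⊤

/-!
On a disc of radius `ρ ∈ (3|z|, 4|z|)` about `0` the Poisson–Jensen formula writes `log |f|`
as a harmonic function plus the sum of `D(a) log |B_a|` over the zeros and poles `a`, where `D` is
the divisor of `f` and `B_a` the Blaschke factor. If `T(r, f) ≤ r ^ p` eventually and `p < s < 1`,
the total mass `∑ |D(a)|` in a disc of radius `r` is `O(r ^ p)`, so the radial potential
`∑ |D(a)| / (1 + |r - |a||)` is at most `r ^ (s - 1)` for `r` outside a set `E` of finite
logarithmic measure. For `|z| = r ∉ E` there is then no zero or pole within distance comparable to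
`r ^ (1 - s)` of `z`, and moving `z` by that distance changes `log |f|` by a bounded amount only.
Thus `|f| ≤ M |f(z)|` on a disc of radius `R ≈ r ^ (1 - s)` about `z`; there Cauchy's estimates and
the mean value inequality give `|Δᵏf(z) - ηᵏ f⁽ᵏ⁾(z)| = O(|f(z)| R ^ (-(k + 1)))`.
-/

open Filter MeasureTheory Metric MeromorphicOn Real Set Topology ValueDistribution

section Log

theorem posLog_add_posLog_inv (x : ℝ) : log⁺ x + log⁺ x⁻¹ = |log x| := by
  rw [posLog_apply, posLog_apply, log_inv, max_comm, max_comm 0,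
    max_zero_add_max_neg_zero_eq_abs_self]

theorem abs_log_sub_log_le {x y : ℝ} (hy : 0 < y) (h : |x - y| ≤ y / 2) :
    |log x - log y| ≤ 2 * |x - y| / y := by
  have hx : 0 < x := by linarith [(abs_le.1 h).1]
  have upper := log_le_sub_one_of_pos (div_pos hx hy)
  have lower := one_sub_inv_le_log_of_pos (div_pos hx hy)
  rw [log_div hx.ne' hy.ne'] at upper lower
  rw [abs_le]
  constructor
  · refine le_trans ?_ lower
    rw [inv_div, one_sub_div hx.ne', neg_le, ← neg_div, neg_sub, div_le_div_iff₀ hx hy]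
    nlinarith [neg_le_abs (x - y), abs_nonneg (x - y)]
  · refine upper.trans ?_
    rw [div_sub_one hy.ne']
    gcongr
    linarith [le_abs_self (x - y), abs_nonneg (x - y)]

theorem abs_log_norm_sub_log_norm_le {E : Type*} [NormedAddCommGroup E] {x y : E} (hy : y ≠ 0)
    (h : ‖x - y‖ ≤ ‖y‖ / 2) : |log ‖x‖ - log ‖y‖| ≤ 2 * ‖x - y‖ / ‖y‖ := by
  have hxy : |‖x‖ - ‖y‖| ≤ ‖x - y‖ := abs_norm_sub_norm_le x y
  calc |log ‖x‖ - log ‖y‖| ≤ 2 * |‖x‖ - ‖y‖| / ‖y‖ :=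
        abs_log_sub_log_le (norm_pos_iff.2 hy) (hxy.trans h)
    _ ≤ 2 * ‖x - y‖ / ‖y‖ := by gcongr

end Log

section CanonicalFactor

open scoped ComplexConjugate

variable {ρ : ℝ} {a v w z : ℂ}

theorem half_sq_le_norm_sq_sub_conj_mul (ha : ‖a‖ ≤ ρ) (hv : ‖v‖ ≤ ρ / 2) :
    ρ ^ 2 / 2 ≤ ‖(ρ : ℂ) ^ 2 - conj a * v‖ := by
  have hρ : 0 ≤ ρ := (norm_nonneg a).trans ha
  have hav : ‖conj a * v‖ ≤ ρ * (ρ / 2) := by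
    rw [norm_mul, RCLike.norm_conj]
    gcongr
  have hsub := norm_sub_norm_le ((ρ : ℂ) ^ 2) (conj a * v)
  rw [norm_pow, Complex.norm_real, norm_eq_abs, sq_abs] at hsub
  linarith

theorem log_norm_canonicalFactor (hρ : 0 < ρ) (ha : ‖a‖ ≤ ρ) (hv : ‖v‖ ≤ ρ / 2) (hva : v ≠ a) :
    log ‖Complex.canonicalFactor ρ a v‖ =
      log ‖(ρ : ℂ) ^ 2 - conj a * v‖ - (log ρ + log ‖v - a‖) := by
  have hnum : ‖(ρ : ℂ) ^ 2 - conj a * v‖ ≠ 0 :=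
    (lt_of_lt_of_le (by positivity) (half_sq_le_norm_sq_sub_conj_mul ha hv)).ne'
  have hva' : ‖v - a‖ ≠ 0 := norm_ne_zero_iff.2 (sub_ne_zero.2 hva)
  rw [Complex.canonicalFactor_apply, norm_div, norm_mul, Complex.norm_real, norm_eq_abs,
    abs_of_pos hρ, log_div hnum (mul_ne_zero hρ.ne' hva'), log_mul hρ.ne' hva']

theorem abs_log_norm_canonicalFactor_sub_le (hρ : 0 < ρ) (ha : ‖a‖ ≤ ρ)
    (hz : ‖z‖ ≤ ρ / 2) (hw : ‖w‖ ≤ ρ / 2) (hwz : ‖w - z‖ ≤ ρ / 4) (hza : z ≠ a)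
    (hwa : ‖w - z‖ ≤ ‖z - a‖ / 2) :
    |log ‖Complex.canonicalFactor ρ a w‖ - log ‖Complex.canonicalFactor ρ a z‖|
      ≤ 4 * ‖w - z‖ / ρ + 2 * ‖w - z‖ / ‖z - a‖ := by
  have hza' : 0 < ‖z - a‖ := norm_pos_iff.2 (sub_ne_zero.2 hza)
  have hwa' : w ≠ a := by
    rintro rfl
    rw [norm_sub_rev] at hwa
    linarith
  set N : ℂ → ℂ := fun v => (ρ : ℂ) ^ 2 - conj a * v
  have hN : ρ ^ 2 / 2 ≤ ‖N z‖ := half_sq_le_norm_sq_sub_conj_mul ha hz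
  have hNpos : 0 < ‖N z‖ := lt_of_lt_of_le (by positivity) hN
  have hNsub : ‖N w - N z‖ ≤ ρ * ‖w - z‖ := by
    rw [show N w - N z = conj a * (z - w) by simp only [N]; ring, norm_mul, RCLike.norm_conj,
      norm_sub_rev z w]
    gcongr
  have numerator : |log ‖N w‖ - log ‖N z‖| ≤ 4 * ‖w - z‖ / ρ :=
    calc |log ‖N w‖ - log ‖N z‖| ≤ 2 * ‖N w - N z‖ / ‖N z‖ :=
          abs_log_norm_sub_log_norm_le (norm_pos_iff.1 hNpos) (by nlinarith)
      _ ≤ 2 * (ρ * ‖w - z‖) / (ρ ^ 2 / 2) := by gcongr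
      _ = 4 * ‖w - z‖ / ρ := by field_simp; ring
  have denominator : |log ‖w - a‖ - log ‖z - a‖| ≤ 2 * ‖w - z‖ / ‖z - a‖ := by
    simpa using abs_log_norm_sub_log_norm_le (x := w - a) (sub_ne_zero.2 hza) (by simpa using hwa)
  rw [log_norm_canonicalFactor hρ ha hw hwa', log_norm_canonicalFactor hρ ha hz hza,
    sub_sub_sub_comm, add_sub_add_left_eq_sub]
  exact (abs_sub _ _).trans (add_le_add numerator denominator)

end CanonicalFactor

section Harmonic

variable {ρ : ℝ} {c w z ζ : ℂ}

theorem abs_re_herglotzRieszKernel_sub_le (hρ : 0 < ρ) (hz : z ∈ closedBall c (ρ / 2))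
    (hw : w ∈ closedBall c (ρ / 2)) (hζ : ζ ∈ sphere c ρ) :
    |(herglotzRieszKernel c w ζ).re - (herglotzRieszKernel c z ζ).re| ≤ 8 * ‖w - z‖ / ρ := by
  rw [mem_sphere_iff_norm] at hζ
  have hden : ∀ v ∈ closedBall c (ρ / 2), ρ / 2 ≤ ‖ζ - v‖ := fun v hv => by
    have := norm_sub_norm_le (ζ - c) (v - c)
    rw [sub_sub_sub_cancel_right] at this
    rw [mem_closedBall_iff_norm] at hv
    linarith
  have hne : ∀ v ∈ closedBall c (ρ / 2), ζ - v ≠ 0 := fun v hv =>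
    norm_pos_iff.1 (lt_of_lt_of_le (by positivity) (hden v hv))
  have kernel_sub : herglotzRieszKernel c w ζ - herglotzRieszKernel c z ζ
      = 2 * (ζ - c) * (w - z) / ((ζ - w) * (ζ - z)) := by
    rw [herglotzRieszKernel_def, herglotzRieszKernel_def, sub_sub_sub_cancel_right,
      sub_sub_sub_cancel_right, div_sub_div _ _ (hne w hw) (hne z hz)]
    ring
  rw [← Complex.sub_re, kernel_sub]
  calc _ ≤ ‖2 * (ζ - c) * (w - z) / ((ζ - w) * (ζ - z))‖ := Complex.abs_re_le_norm _
    _ = 2 * ρ * ‖w - z‖ / (‖ζ - w‖ * ‖ζ - z‖) := by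
        rw [norm_div, norm_mul, norm_mul, norm_mul, hζ, Complex.norm_ofNat]
    _ ≤ 2 * ρ * ‖w - z‖ / ((ρ / 2) * (ρ / 2)) := by
        gcongr
        exacts [hden w hw, hden z hz]
    _ = 8 * ‖w - z‖ / ρ := by field_simp; ring

theorem abs_sub_le_of_harmonicOnNhd {u : ℂ → ℝ}
    (hu : InnerProductSpace.HarmonicOnNhd u (closedBall c ρ)) (hρ : 0 < ρ)
    (hz : z ∈ closedBall c (ρ / 2)) (hw : w ∈ closedBall c (ρ / 2)) :
    |u w - u z| ≤ 8 * ‖w - z‖ / ρ * circleAverage |u| c ρ := by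
  have hball : closedBall c (ρ / 2) ⊆ ball c ρ := closedBall_subset_ball (by linarith)
  have hcont : ContinuousOn u (sphere c |ρ|) := by
    rw [abs_of_pos hρ]
    exact hu.continuousOn.mono sphere_subset_closedBall
  set P : ℂ → ℂ → ℝ := fun v => (Complex.re ∘ herglotzRieszKernel c v) • u
  have hP : ∀ v ∈ closedBall c (ρ / 2), ContinuousOn (P v) (sphere c |ρ|) := fun v hv =>
    (Complex.continuous_re.comp_continuousOn
      (continuousOn_herglotzRieszKernel_sphere (hball hv))).smul hcont
  calc |u w - u z| = |circleAverage (P w - P z) c ρ| := by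
        rw [circleAverage_sub (hP w hw).circleIntegrable' (hP z hz).circleIntegrable',
          hu.circleAverage_re_herglotzRieszKernel_smul (hball hw),
          hu.circleAverage_re_herglotzRieszKernel_smul (hball hz)]
    _ ≤ circleAverage |P w - P z| c ρ := abs_circleAverage_le_circleAverage_abs
    _ ≤ circleAverage ((8 * ‖w - z‖ / ρ) • |u|) c ρ := by
        refine circleAverage_mono ((hP w hw).sub (hP z hz)).abs.circleIntegrable'
          (hcont.abs.const_smul _).circleIntegrable' fun ζ hζ => ?_
        rw [abs_of_pos hρ] at hζ
        simp only [P, Pi.abs_apply, Pi.sub_apply, Pi.smul_apply, smul_eq_mul, Pi.mul_apply,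
          Function.comp_apply]
        rw [← sub_mul, abs_mul]
        exact mul_le_mul_of_nonneg_right (abs_re_herglotzRieszKernel_sub_le hρ hz hw hζ)
          (abs_nonneg _)
    _ = 8 * ‖w - z‖ / ρ * circleAverage |u| c ρ := by rw [circleAverage_smul, smul_eq_mul]

end Harmonic

section PoissonJensen

variable {g h : ℂ → ℂ} {ρ : ℝ} {S : Finset ℂ} {v w z : ℂ}

theorem circleAverage_abs_log_norm (hg : MeromorphicOn g (sphere 0 |ρ|)) :
    circleAverage |fun x => log ‖g x‖| 0 ρ = proximity g ⊤ ρ + proximity g⁻¹ ⊤ ρ := by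
  rw [proximity_top, proximity_top,
    ← circleAverage_add hg.circleIntegrable_posLog_norm hg.inv.circleIntegrable_posLog_norm]
  congr 1
  ext x
  simp only [Pi.abs_apply, Pi.add_apply, Pi.inv_apply, norm_inv, posLog_add_posLog_inv]

theorem meromorphicOrderAt_ne_zero_of_divisor_ne_zero {U : Set ℂ} {a : ℂ}
    (hg : MeromorphicOn g U) (ha : divisor g U a ≠ 0) : meromorphicOrderAt g a ≠ 0 := by
  intro h0
  rw [hg.divisor_apply ((divisor g U).supportWithinDomain ha), h0] at ha
  exact ha rfl

theorem log_norm_eq_sum_log_norm_canonicalFactor_add (D : Complex.ECanonicalDecomp g h ρ)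
    (hρ : 0 < ρ) (hsphere : ∀ a ∈ sphere 0 ρ, meromorphicOrderAt g a = 0)
    (hS : (divisor g (ball 0 ρ)).support ⊆ S) (hv : v ∈ closedBall 0 ρ)
    (hgv : MeromorphicNFAt g v) (hv0 : meromorphicOrderAt g v = 0) :
    log ‖h v‖ =
      ∑ a ∈ S, divisor g (ball 0 ρ) a * log ‖Complex.canonicalFactor ρ a v‖ + log ‖g v‖ := by
  have divisor_sphere : divisor g (sphere 0 ρ) = 0 := by
    ext a
    by_contra ha
    exact meromorphicOrderAt_ne_zero_of_divisor_ne_zero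
      (D.meromorphicOn.mono_set sphere_subset_closedBall) ha
      (hsphere a ((divisor g (sphere 0 ρ)).supportWithinDomain ha))
  have hAn : AnalyticAt ℂ g v := hgv.meromorphicOrderAt_nonneg_iff_analyticAt.1 hv0.ge
  rw [D.log_norm_eq hv hv0 hρ,
    hAn.meromorphicTrailingCoeffAt_of_ne_zero (hgv.meromorphicOrderAt_eq_zero_iff.1 hv0),
    divisor_sphere, finsum_eq_sum_of_support_subset _ fun a ha => hS ?_]
  · simp only [Function.locallyFinsuppWithin.coe_zero, Pi.zero_apply, Int.cast_zero, zero_mul,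
      finsum_zero, sub_zero]
  · exact fun h0 => ha (by simp only [h0, Int.cast_zero, zero_mul])

theorem circleAverage_abs_log_norm_of_ecanonicalDecomp (D : Complex.ECanonicalDecomp g h ρ)
    (hρ : 0 < ρ) (hg : MeromorphicNFOn g (sphere 0 ρ))
    (hsphere : ∀ a ∈ sphere 0 ρ, meromorphicOrderAt g a = 0) :
    circleAverage |fun x => log ‖h x‖| 0 ρ = proximity g ⊤ ρ + proximity g⁻¹ ⊤ ρ := by
  rw [← circleAverage_abs_log_norm (by rw [abs_of_pos hρ]; exact hg.meromorphicOn)]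
  refine circleAverage_congr_sphere fun v hv => ?_
  rw [abs_of_pos hρ] at hv
  simp only [Pi.abs_apply]
  rw [log_norm_eq_sum_log_norm_canonicalFactor_add D hρ hsphere
      D.meromorphicOn.divisor_ball_support_finite.coe_toFinset.ge (sphere_subset_closedBall hv)
      (hg hv) (hsphere v hv),
    Finset.sum_eq_zero, zero_add]
  intro a ha
  rw [Complex.norm_canonicalFactor_eval_circle_eq_one
    ((divisor g (ball 0 ρ)).supportWithinDomain (by simpa using ha)) hv, log_one, mul_zero]

theorem abs_sum_log_norm_canonicalFactor_sub_le (hg : MeromorphicOn g (ball 0 ρ)) (hρ : 0 < ρ)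
    (hz : ‖z‖ ≤ ρ / 2) (hw : ‖w‖ ≤ ρ / 2) (hwz : ‖w - z‖ ≤ ρ / 4)
    (hz0 : meromorphicOrderAt g z = 0)
    (hsep : ∀ a ∈ (divisor g (ball 0 ρ)).support, ‖w - z‖ ≤ ‖z - a‖ / 2) :
    |∑ a ∈ S, divisor g (ball 0 ρ) a * log ‖Complex.canonicalFactor ρ a w‖
        - ∑ a ∈ S, divisor g (ball 0 ρ) a * log ‖Complex.canonicalFactor ρ a z‖|
      ≤ ∑ a ∈ S, |(divisor g (ball 0 ρ) a : ℝ)|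
          * (4 * ‖w - z‖ / ρ + 2 * ‖w - z‖ / ‖z - a‖) := by
  rw [← Finset.sum_sub_distrib]
  refine (Finset.abs_sum_le_sum_abs _ _).trans (Finset.sum_le_sum fun a _ => ?_)
  rw [← mul_sub, abs_mul]
  by_cases ha : divisor g (ball 0 ρ) a = 0
  · simp only [ha, Int.cast_zero, abs_zero, zero_mul, le_refl]
  have haρ : ‖a‖ ≤ ρ :=
    (mem_ball_zero_iff.1 ((divisor g (ball 0 ρ)).supportWithinDomain ha)).le
  have hza : z ≠ a := by
    rintro rfl
    exact meromorphicOrderAt_ne_zero_of_divisor_ne_zero hg ha hz0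
  exact mul_le_mul_of_nonneg_left
    (abs_log_norm_canonicalFactor_sub_le hρ haρ hz hw hwz hza (hsep a ha)) (abs_nonneg _)

theorem abs_log_norm_sub_le_proximity_add_sum (hg : MeromorphicNFOn g (closedBall 0 ρ))
    (hρ : 0 < ρ) (hfin : ∀ a ∈ closedBall 0 ρ, meromorphicOrderAt g a ≠ ⊤)
    (hsphere : ∀ a ∈ sphere 0 ρ, meromorphicOrderAt g a = 0)
    (hz : ‖z‖ ≤ ρ / 2) (hw : ‖w‖ ≤ ρ / 2) (hwz : ‖w - z‖ ≤ ρ / 4)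
    (hz0 : meromorphicOrderAt g z = 0) (hw0 : meromorphicOrderAt g w = 0)
    (hsep : ∀ a ∈ (divisor g (ball 0 ρ)).support, ‖w - z‖ ≤ ‖z - a‖ / 2)
    (hS : (divisor g (ball 0 ρ)).support ⊆ S) :
    |log ‖g w‖ - log ‖g z‖| ≤ 8 * ‖w - z‖ / ρ * (proximity g ⊤ ρ + proximity g⁻¹ ⊤ ρ)
      + ∑ a ∈ S, |(divisor g (ball 0 ρ) a : ℝ)|
          * (4 * ‖w - z‖ / ρ + 2 * ‖w - z‖ / ‖z - a‖) := by
  obtain ⟨h, D⟩ := hg.meromorphicOn.exists_ecanonicalDecomp fun u => hfin u u.2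
  have mem_closedBall {r : ℝ} {v : ℂ} (hv : ‖v‖ ≤ r) : v ∈ closedBall 0 r :=
    mem_closedBall_zero_iff.2 hv
  have harmonic : InnerProductSpace.HarmonicOnNhd (fun x => log ‖h x‖) (closedBall 0 ρ) :=
    fun x hx => (D.analyticOnNhd x hx).harmonicAt_log_norm (D.ne_zero x hx)
  have regular_part := abs_sub_le_of_harmonicOnNhd harmonic hρ (mem_closedBall hz)
    (mem_closedBall hw)
  rw [circleAverage_abs_log_norm_of_ecanonicalDecomp D hρ
    (fun x hx => hg (sphere_subset_closedBall hx)) hsphere] at regular_part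
  have formula {v : ℂ} (hv : ‖v‖ ≤ ρ / 2) (hv0 : meromorphicOrderAt g v = 0) :=
    have hv' : v ∈ closedBall 0 ρ := mem_closedBall (by linarith)
    log_norm_eq_sum_log_norm_canonicalFactor_add D hρ hsphere hS hv' (hg hv') hv0
  have factor_part := abs_sum_log_norm_canonicalFactor_sub_le (S := S)
    (D.meromorphicOn.mono_set ball_subset_closedBall) hρ hz hw hwz hz0 hsep
  refine le_trans ?_ (add_le_add regular_part factor_part)
  refine le_trans (le_of_eq ?_) (abs_sub _ _)
  rw [formula hw hw0, formula hz hz0]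
  congr 1
  ring

end PoissonJensen

theorem rpow_neg_mul_rpow_neg_le {u v a b : ℝ} (hu : 0 < u) (hv : 0 < v) (ha : 0 ≤ a)
    (hb : 0 ≤ b) : u ^ (-a) * v ^ (-b) ≤ u ^ (-(a + b)) + v ^ (-(a + b)) := by
  have split {x : ℝ} (hx : 0 < x) : x ^ (-(a + b)) = x ^ (-a) * x ^ (-b) := by
    rw [neg_add, rpow_add hx]
  rcases le_total u v with huv | hvu
  · calc u ^ (-a) * v ^ (-b) ≤ u ^ (-a) * u ^ (-b) := by
          gcongr ?_ * ?_
          exact rpow_le_rpow_of_nonpos hu huv (by linarith)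
      _ ≤ u ^ (-(a + b)) + v ^ (-(a + b)) := by
          rw [split hu]
          exact le_add_of_nonneg_right (by positivity)
  · calc u ^ (-a) * v ^ (-b) ≤ v ^ (-a) * v ^ (-b) := by
          gcongr ?_ * ?_
          exact rpow_le_rpow_of_nonpos hv hvu (by linarith)
      _ ≤ u ^ (-(a + b)) + v ^ (-(a + b)) := by
          rw [split hv]
          exact le_add_of_nonneg_left (by positivity)

-- For `α < s` the exponents `-(1 + s - α)` on the right are `< -1`, hence integrable at infinity.
theorem rpow_neg_mul_inv_le_of_le_add {u v y α s : ℝ} (hu : 0 < u) (hv : 0 < v) (hy : 0 < y)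
    (hyuv : y ≤ u + v) (hα : 0 ≤ α) (hα1 : α ≤ 1) (hαs : α ≤ s) :
    u ^ (-s) * v⁻¹ ≤ 2 * (u ^ (-(1 + s - α)) + v ^ (-(1 + s - α))) * y ^ (-α) := by
  have h₁ : u ^ (-(s - α)) * v ^ (-1 : ℝ) ≤ u ^ (-(1 + s - α)) + v ^ (-(1 + s - α)) := by
    convert rpow_neg_mul_rpow_neg_le hu hv (sub_nonneg.2 hαs) zero_le_one using 3 <;> ring
  have h₂ : u ^ (-s) * v ^ (-(1 - α)) ≤ u ^ (-(1 + s - α)) + v ^ (-(1 + s - α)) := by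
    convert rpow_neg_mul_rpow_neg_le hu hv (hα.trans hαs) (sub_nonneg.2 hα1) using 3 <;> ring
  have hyα : y ^ α ≤ u ^ α + v ^ α :=
    (rpow_le_rpow hy.le hyuv hα).trans (rpow_add_le_add_rpow hu.le hv.le hα hα1)
  rw [rpow_neg hy.le, le_mul_inv_iff₀ (rpow_pos_of_pos hy α)]
  calc u ^ (-s) * v⁻¹ * y ^ α ≤ u ^ (-s) * v⁻¹ * (u ^ α + v ^ α) := by gcongr
    _ = u ^ (-(s - α)) * v ^ (-1 : ℝ) + u ^ (-s) * v ^ (-(1 - α)) := by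
        rw [show -(s - α) = -s + α by ring, rpow_add hu, show -(1 - α) = -1 + α by ring,
          rpow_add hv, rpow_neg_one]
        ring
    _ ≤ 2 * (u ^ (-(1 + s - α)) + v ^ (-(1 + s - α))) := by linarith

theorem exists_lintegral_one_add_abs_rpow_mul_inv_le {α s : ℝ} (hα : 0 ≤ α) (hα1 : α ≤ 1)
    (hαs : α < s) :
    ∃ K < ⊤, ∀ t : ℝ, ∫⁻ r : ℝ, ENNReal.ofReal ((1 + |r|) ^ (-s) * (1 + |r - t|)⁻¹)
      ≤ K * ENNReal.ofReal ((1 + |t|) ^ (-α)) := by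
  set w : ℝ → ℝ := fun r => (1 + |r|) ^ (-(1 + s - α))
  have hw0 : ∀ r, 0 ≤ w r := fun r => by positivity
  have hwm : Measurable w := by fun_prop
  have hw_lt_top : ∫⁻ r, ENNReal.ofReal (w r) < ⊤ := by
    have := finite_integral_one_add_norm (E := ℝ) (μ := volume) (r := 1 + s - α)
      (by rw [Module.finrank_self]; push_cast; linarith)
    simpa only [norm_eq_abs] using this
  set J := ∫⁻ r, ENNReal.ofReal (w r)
  refine ⟨2 * (J + J), ENNReal.mul_lt_top ENNReal.ofNat_lt_top (ENNReal.add_lt_top.2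
    ⟨hw_lt_top, hw_lt_top⟩), fun t => ?_⟩
  have htri (r : ℝ) : 1 + |t| ≤ (1 + |r|) + (1 + |r - t|) := by
    have := abs_sub_abs_le_abs_sub t r
    rw [abs_sub_comm] at this
    linarith
  calc _ ≤ ∫⁻ r, ENNReal.ofReal (2 * (w r + w (r - t)) * (1 + |t|) ^ (-α)) :=
        lintegral_mono fun r => ENNReal.ofReal_le_ofReal <| rpow_neg_mul_inv_le_of_le_add
          (by positivity) (by positivity) (by positivity) (htri r) hα hα1 hαs.le
    _ = ∫⁻ r, 2 * (ENNReal.ofReal (w r) + ENNReal.ofReal (w (r - t)))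
          * ENNReal.ofReal ((1 + |t|) ^ (-α)) := by
        refine lintegral_congr fun r => ?_
        have := hw0 r
        have := hw0 (r - t)
        rw [ENNReal.ofReal_mul (by positivity), ENNReal.ofReal_mul zero_le_two,
          ENNReal.ofReal_add (hw0 r) (hw0 (r - t)), ENNReal.ofReal_ofNat]
    _ = 2 * (J + J) * ENNReal.ofReal ((1 + |t|) ^ (-α)) := by
        rw [lintegral_mul_const _ (by fun_prop), lintegral_const_mul _ (by fun_prop),
          lintegral_add_left (by fun_prop),
          lintegral_sub_right_eq_self (fun r => ENNReal.ofReal (w r)) t]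

/-- The potential of the image of `μ` under `x ↦ ‖x‖` with respect to the kernel
`(1 + |r - t|)⁻¹`: it measures how much mass lies on spheres of radius close to `r`. -/
noncomputable def radialPotential {E : Type*} [Norm E] [MeasurableSpace E] (μ : Measure E)
    (r : ℝ) : ENNReal :=
  ∫⁻ x, ENNReal.ofReal (1 + |r - ‖x‖|)⁻¹ ∂μ

section RadialPotential

variable {E : Type*} [NormedAddCommGroup E] [MeasurableSpace E] [OpensMeasurableSpace E]
  {μ : Measure E} {C p s : ℝ}

theorem lintegral_one_add_norm_rpow_neg_lt_top
    (hμ : ∀ r, 0 ≤ r → μ (closedBall 0 r) ≤ ENNReal.ofReal (C * (1 + r) ^ p))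
    (hp : 0 ≤ p) (hps : p < s) :
    ∫⁻ x, ENNReal.ofReal ((1 + ‖x‖) ^ (-s)) ∂μ < ⊤ := by
  have hs : 0 < s := hp.trans_lt hps
  have superlevel : ∀ t ∈ Ioi (0 : ℝ), μ {x | t ≤ (1 + ‖x‖)⁻¹} * ENNReal.ofReal (t ^ (s - 1))
      ≤ (Ioc 0 1).indicator (fun t => ENNReal.ofReal (C * t ^ (s - 1 - p))) t := by
    intro t (ht : 0 < t)
    have hball : {x : E | t ≤ (1 + ‖x‖)⁻¹} = closedBall 0 (t⁻¹ - 1) := by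
      ext x
      rw [mem_ofPred_eq, mem_closedBall_zero_iff, le_inv_comm₀ ht (by positivity),
        le_sub_iff_add_le']
    rw [hball]
    by_cases ht1 : t ≤ 1
    · have hμt := hμ (t⁻¹ - 1) (sub_nonneg.2 ((one_le_inv₀ ht).2 ht1))
      rw [add_sub_cancel, inv_rpow ht.le, ← rpow_neg ht.le] at hμt
      rw [indicator_of_mem (show t ∈ Ioc (0 : ℝ) 1 from ⟨ht, ht1⟩)]
      refine (mul_le_mul_left hμt _).trans_eq ?_
      rw [← ENNReal.ofReal_mul' (by positivity), mul_assoc, ← rpow_add ht, neg_add_eq_sub]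
    · rw [closedBall_eq_empty.2 (sub_neg.2 (inv_lt_one_of_one_lt₀ (not_le.1 ht1))),
        measure_empty, zero_mul]
      exact zero_le
  have integrable : IntegrableOn (fun t : ℝ => C * t ^ (s - 1 - p)) (Ioc 0 1) :=
    ((intervalIntegrable_iff_integrableOn_Ioc_of_le zero_le_one).1
      (intervalIntegral.intervalIntegrable_rpow' (by linarith))).const_mul C
  calc ∫⁻ x, ENNReal.ofReal ((1 + ‖x‖) ^ (-s)) ∂μ
      = ∫⁻ x, ENNReal.ofReal ((1 + ‖x‖)⁻¹ ^ s) ∂μ := lintegral_congr fun x => by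
        rw [inv_rpow (by positivity), rpow_neg (by positivity)]
    _ = ENNReal.ofReal s * ∫⁻ t in Ioi 0,
          μ {x | t ≤ (1 + ‖x‖)⁻¹} * ENNReal.ofReal (t ^ (s - 1)) :=
        lintegral_rpow_eq_lintegral_meas_le_mul μ (ae_of_all _ fun x => by positivity)
          (by fun_prop) hs
    _ ≤ ENNReal.ofReal s * ∫⁻ t in Ioc 0 1, ENNReal.ofReal (C * t ^ (s - 1 - p)) := by
        refine mul_le_mul_right ?_ _
        refine (setLIntegral_mono' measurableSet_Ioi superlevel).trans ?_
        rw [← lintegral_indicator measurableSet_Ioc]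
        exact setLIntegral_le_lintegral _ _
    _ < ⊤ := ENNReal.mul_lt_top ENNReal.ofReal_lt_top integrable.lintegral_lt_top

variable [SFinite μ]

theorem measurable_radialPotential : Measurable (radialPotential μ) :=
  Measurable.lintegral_prod_right' (f := fun q : ℝ × E => ENNReal.ofReal (1 + |q.1 - ‖q.2‖|)⁻¹)
    (by fun_prop)

theorem lintegral_mul_radialPotential_lt_top
    (hμ : ∀ r, 0 ≤ r → μ (closedBall 0 r) ≤ ENNReal.ofReal (C * (1 + r) ^ p))
    (hp : 0 ≤ p) (hps : p < s) (hs : s ≤ 1) :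
    ∫⁻ r : ℝ, ENNReal.ofReal ((1 + |r|) ^ (-s)) * radialPotential μ r < ⊤ := by
  obtain ⟨α, hpα, hαs⟩ := exists_between hps
  obtain ⟨K, hK, hkernel⟩ := exists_lintegral_one_add_abs_rpow_mul_inv_le (hp.trans hpα.le)
    (hαs.le.trans hs) hαs
  calc ∫⁻ r : ℝ, ENNReal.ofReal ((1 + |r|) ^ (-s)) * radialPotential μ r
      = ∫⁻ r : ℝ, (∫⁻ x, ENNReal.ofReal ((1 + |r|) ^ (-s) * (1 + |r - ‖x‖|)⁻¹) ∂μ) :=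
        lintegral_congr fun r => by
          rw [radialPotential, ← lintegral_const_mul _ (by fun_prop)]
          exact lintegral_congr fun x => (ENNReal.ofReal_mul (by positivity)).symm
    _ = ∫⁻ x, (∫⁻ r : ℝ, ENNReal.ofReal ((1 + |r|) ^ (-s) * (1 + |r - ‖x‖|)⁻¹)) ∂μ :=
        lintegral_lintegral_swap (by fun_prop)
    _ ≤ ∫⁻ x, K * ENNReal.ofReal ((1 + ‖x‖) ^ (-α)) ∂μ := lintegral_mono fun x => by
        simpa only [abs_norm] using hkernel ‖x‖
    _ = K * ∫⁻ x, ENNReal.ofReal ((1 + ‖x‖) ^ (-α)) ∂μ := lintegral_const_mul _ (by fun_prop)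
    _ < ⊤ := ENNReal.mul_lt_top hK (lintegral_one_add_norm_rpow_neg_lt_top hμ hp hpα)

theorem exists_hasFiniteLogMeasure_radialPotential_le
    (hμ : ∀ r, 0 ≤ r → μ (closedBall 0 r) ≤ ENNReal.ofReal (C * (1 + r) ^ p))
    (hp : 0 ≤ p) (hps : p < s) (hs : s ≤ 1) :
    ∃ E ⊆ Ioi (1 : ℝ), HasFiniteLogMeasure E ∧
      ∀ r, 1 < r → r ∉ E → radialPotential μ r ≤ ENNReal.ofReal (r ^ (s - 1)) := by
  set E : Set ℝ := Ioi 1 ∩ {r | ENNReal.ofReal (r ^ (s - 1)) < radialPotential μ r}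
  have hEm : MeasurableSet E :=
    measurableSet_Ioi.inter (measurableSet_lt (by fun_prop) measurable_radialPotential)
  refine ⟨E, inter_subset_left, ⟨hEm, ?_⟩, fun r hr hrE => not_lt.1 fun h => hrE ⟨hr, h⟩⟩
  have weight {r : ℝ} (hr : 1 < r) : 1 / r ≤ 2 * ((1 + |r|) ^ (-s) * r ^ (s - 1)) := by
    rw [abs_of_pos (by linarith)]
    calc 1 / r ≤ 2 * (1 + r)⁻¹ := by
          rw [← div_eq_mul_inv, div_le_div_iff₀ (by linarith) (by linarith)]
          linarith
      _ = 2 * ((1 + r) ^ (-s) * (1 + r) ^ (s - 1)) := by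
          rw [← rpow_add (by linarith), ← rpow_neg_one]
          ring_nf
      _ ≤ 2 * ((1 + r) ^ (-s) * r ^ (s - 1)) := by
          gcongr ?_ * (?_ * ?_)
          exact rpow_le_rpow_of_nonpos (by linarith) (by linarith) (by linarith)
  calc ∫⁻ r in E, ENNReal.ofReal (1 / r)
      ≤ ∫⁻ r in E, 2 * (ENNReal.ofReal ((1 + |r|) ^ (-s)) * radialPotential μ r) := by
        refine setLIntegral_mono' hEm fun r hr => ?_
        refine (ENNReal.ofReal_le_ofReal (weight hr.1)).trans ?_
        rw [ENNReal.ofReal_mul zero_le_two, ENNReal.ofReal_ofNat,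
          ENNReal.ofReal_mul (by positivity)]
        gcongr
        exact hr.2.le
    _ ≤ ∫⁻ r, 2 * (ENNReal.ofReal ((1 + |r|) ^ (-s)) * radialPotential μ r) :=
        setLIntegral_le_lintegral _ _
    _ = 2 * ∫⁻ r, ENNReal.ofReal ((1 + |r|) ^ (-s)) * radialPotential μ r :=
        lintegral_const_mul _ (Measurable.mul (by fun_prop) measurable_radialPotential)
    _ < ⊤ := ENNReal.mul_lt_top ENNReal.ofNat_lt_top
        (lintegral_mul_radialPotential_lt_top hμ hp hps hs)

end RadialPotential

/-- The divisor `D` with multiplicities replaced by their absolute values, as a measure: a point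
`a` carries the mass `|D a|`. The sum runs over the support only, so that it is countable. -/
noncomputable def divisorMeasure {X : Type*} [TopologicalSpace X] [MeasurableSpace X]
    (D : Function.locallyFinsupp X ℤ) : Measure X :=
  Measure.sum fun a : D.support => ENNReal.ofReal |(D a : ℝ)| • Measure.dirac (a : X)

section DivisorMeasure

variable {X : Type*} [TopologicalSpace X] {D : Function.locallyFinsupp X ℤ}

theorem countable_support_locallyFinsupp [T1Space X] [HereditarilyLindelofSpace X] :
    D.support.Countable :=
  (HereditarilyLindelofSpace.isLindelof _).countable_of_isDiscrete D.discreteSupport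

variable [MeasurableSpace X]

instance sFinite_divisorMeasure [T1Space X] [HereditarilyLindelofSpace X] :
    SFinite (divisorMeasure D) :=
  have : Countable D.support := countable_support_locallyFinsupp.to_subtype
  inferInstanceAs (SFinite (Measure.sum _))

variable [MeasurableSingletonClass X]

theorem lintegral_divisorMeasure (φ : X → ENNReal) :
    ∫⁻ a, φ a ∂divisorMeasure D = ∑' a, ENNReal.ofReal |(D a : ℝ)| * φ a := by
  rw [divisorMeasure, lintegral_sum_measure]
  simp only [lintegral_smul_measure, lintegral_dirac, smul_eq_mul]
  refine tsum_subtype_eq_of_support_subset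
    (f := fun a => ENNReal.ofReal |(D a : ℝ)| * φ a) fun a ha h => ha ?_
  simp [h]

theorem divisorMeasure_le_ofReal {s : Set X} (hs : MeasurableSet s) {c : ℝ}
    (h : ∀ S : Finset X, ↑S ⊆ s → ∑ a ∈ S, |(D a : ℝ)| ≤ c) :
    divisorMeasure D s ≤ ENNReal.ofReal c := by
  classical
  rw [← lintegral_indicator_one hs, lintegral_divisorMeasure, ENNReal.tsum_eq_iSup_sum]
  refine iSup_le fun S => ?_
  calc ∑ a ∈ S, ENNReal.ofReal |(D a : ℝ)| * s.indicator 1 a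
      = ∑ a ∈ S with a ∈ s, ENNReal.ofReal |(D a : ℝ)| := by
        simp only [Finset.sum_filter, indicator_apply, Pi.one_apply, mul_ite, mul_one, mul_zero]
    _ = ENNReal.ofReal (∑ a ∈ S with a ∈ s, |(D a : ℝ)|) :=
        (ENNReal.ofReal_sum_of_nonneg fun _ _ => abs_nonneg _).symm
    _ ≤ ENNReal.ofReal c := ENNReal.ofReal_le_ofReal <| h _ fun a ha => by simp_all

theorem ofReal_sum_mul_le_lintegral_divisorMeasure (S : Finset X) {φ : X → ℝ}
    (hφ : ∀ a, 0 ≤ φ a) :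
    ENNReal.ofReal (∑ a ∈ S, |(D a : ℝ)| * φ a) ≤ ∫⁻ a, ENNReal.ofReal (φ a) ∂divisorMeasure D := by
  rw [lintegral_divisorMeasure,
    ENNReal.ofReal_sum_of_nonneg fun a _ => mul_nonneg (abs_nonneg _) (hφ a)]
  simp only [ENNReal.ofReal_mul (abs_nonneg _)]
  exact ENNReal.sum_le_tsum S

end DivisorMeasure

section Nevanlinna

theorem mul_log_two_le_logCounting_single
    {E : Type*} [NormedAddCommGroup E] [ProperSpace E] [DecidableEq E] {r : ℝ} {e : E} {n : ℤ}
    (hr : 1 ≤ r) (he : ‖e‖ ≤ r) (hn : 0 ≤ n) :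
    n * log 2 ≤ (Function.locallyFinsuppWithin.single e n).logCounting (2 * r) := by
  rw [Function.locallyFinsuppWithin.logCounting_single_eq_log_sub_const (by linarith),
    log_mul two_ne_zero (by linarith)]
  refine mul_le_mul_of_nonneg_left ?_ (by exact_mod_cast hn)
  rcases eq_or_ne e 0 with rfl | he0
  · simpa using log_nonneg hr
  · linarith [log_le_log (norm_pos_iff.2 he0) he]

theorem sum_mul_log_two_le_logCounting {E : Type*} [NormedAddCommGroup E] [ProperSpace E]
    {D : Function.locallyFinsupp E ℤ} {r : ℝ} (hD : 0 ≤ D) (hr : 1 ≤ r) {S : Finset E}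
    (hS : ∀ a ∈ S, ‖a‖ ≤ r) :
    (∑ a ∈ S, (D a : ℝ)) * log 2 ≤ D.logCounting (2 * r) := by
  classical
  set D_S : Function.locallyFinsupp E ℤ :=
    ∑ a ∈ S, Function.locallyFinsuppWithin.single a (D a) with hD_S
  have hle : D_S ≤ D := by
    intro x
    have : D_S x = if x ∈ S then D x else 0 := by
      simp [hD_S, Function.locallyFinsuppWithin.coe_sum]
    rw [this]
    split_ifs
    exacts [le_rfl, hD x]
  calc (∑ a ∈ S, (D a : ℝ)) * log 2
      ≤ ∑ a ∈ S, (Function.locallyFinsuppWithin.single a (D a)).logCounting (2 * r) := by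
        rw [Finset.sum_mul]
        exact Finset.sum_le_sum fun a ha => mul_log_two_le_logCounting_single hr (hS a ha) (hD a)
    _ = D_S.logCounting (2 * r) := by rw [hD_S, map_sum, Finset.sum_apply]
    _ ≤ D.logCounting (2 * r) :=
        Function.locallyFinsuppWithin.logCounting_le hle (by linarith)

variable {g : ℂ → ℂ} {p r : ℝ}

theorem proximity_add_proximity_inv_le (hr : 1 ≤ r) :
    proximity g ⊤ r + proximity g⁻¹ ⊤ r ≤ characteristic g ⊤ r + characteristic g⁻¹ ⊤ r := by
  simp only [characteristic, Pi.add_apply]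
  linarith [logCounting_nonneg (f := g) (e := ⊤) hr, logCounting_nonneg (f := g⁻¹) (e := ⊤) hr]

theorem sum_abs_divisor_mul_log_two_le (hr : 1 ≤ r) {S : Finset ℂ} (hS : ∀ a ∈ S, ‖a‖ ≤ r) :
    (∑ a ∈ S, |(divisor g univ a : ℝ)|) * log 2
      ≤ characteristic g ⊤ (2 * r) + characteristic g⁻¹ ⊤ (2 * r) := by
  have habs (a : ℂ) : ((divisor g univ)⁺ + (divisor g univ)⁻) a = |divisor g univ a| := by
    rw [Function.locallyFinsuppWithin.coe_add, Pi.add_apply,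
      Function.locallyFinsuppWithin.posPart_apply, Function.locallyFinsuppWithin.negPart_apply]
    exact posPart_add_negPart _
  have hcount := sum_mul_log_two_le_logCounting
    (add_nonneg (posPart_nonneg (divisor g univ)) (negPart_nonneg (divisor g univ))) hr hS
  simp only [habs, Int.cast_abs] at hcount
  rw [map_add, ← logCounting_zero, ← logCounting_top, ← logCounting_inv] at hcount
  simp only [characteristic, Pi.add_apply] at hcount ⊢
  have hm : 0 ≤ proximity g ⊤ (2 * r) := proximity_nonneg _
  have hm_inv : 0 ≤ proximity g⁻¹ ⊤ (2 * r) := proximity_nonneg _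
  linarith

theorem exists_characteristic_add_characteristic_inv_le (hg : Meromorphic g) (hp : 0 ≤ p)
    (hT : ∀ᶠ r in atTop, characteristic g ⊤ r ≤ r ^ p) :
    ∃ C, 0 ≤ C ∧ ∀ r, 1 ≤ r → characteristic g ⊤ r + characteristic g⁻¹ ⊤ r ≤ C * r ^ p := by
  obtain ⟨R, hR, hR1⟩ :=
    ((eventually_forall_ge_atTop.2 hT).and (eventually_ge_atTop 1)).exists
  set K := |log ‖meromorphicTrailingCoeffAt g 0‖|
  refine ⟨2 * R ^ p + K, by positivity, fun r hr => ?_⟩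
  have hgrowth : characteristic g ⊤ r ≤ R ^ p * r ^ p := by
    calc characteristic g ⊤ r ≤ characteristic g ⊤ (R * r) :=
          characteristic_monotoneOn hg (mem_Ioi.2 (by linarith)) (mem_Ioi.2 (by positivity))
            (le_mul_of_one_le_left (by linarith) hR1)
      _ ≤ (R * r) ^ p := hR _ (le_mul_of_one_le_right (by linarith) hr)
      _ = R ^ p * r ^ p := mul_rpow (by linarith) (by linarith)
  have hfirst : characteristic g ⊤ r - characteristic g⁻¹ ⊤ r
      = log ‖meromorphicTrailingCoeffAt g 0‖ :=
    characteristic_sub_characteristic_inv_of_ne_zero hg (by linarith)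
  have hK : K ≤ K * r ^ p := le_mul_of_one_le_right (abs_nonneg _) (one_le_rpow hr hp)
  linarith [neg_abs_le (log ‖meromorphicTrailingCoeffAt g 0‖)]

theorem divisorMeasure_closedBall_le {C : ℝ}
    (hC : ∀ r, 1 ≤ r → characteristic g ⊤ r + characteristic g⁻¹ ⊤ r ≤ C * r ^ p) (hr : 0 ≤ r) :
    divisorMeasure (divisor g univ) (closedBall 0 r)
      ≤ ENNReal.ofReal (2 ^ p * C / log 2 * (1 + r) ^ p) := by
  refine divisorMeasure_le_ofReal measurableSet_closedBall fun S hS => ?_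
  have hsum := sum_abs_divisor_mul_log_two_le (g := g) (r := 1 + r) (by linarith)
    fun a ha => (mem_closedBall_zero_iff.1 (hS ha)).trans (by linarith)
  rw [div_mul_eq_mul_div, le_div_iff₀ (log_pos one_lt_two)]
  calc _ ≤ C * (2 * (1 + r)) ^ p := hsum.trans (hC _ (by linarith))
    _ = 2 ^ p * C * (1 + r) ^ p := by
        rw [mul_rpow two_pos.le (by linarith)]
        ring

theorem nevanlinnaOrder_nonneg (f : ℂ → ℂ) : 0 ≤ nevanlinnaOrder f := by
  refine le_limsup_of_frequently_le (Eventually.frequently ?_)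
  filter_upwards [eventually_ge_atTop 1] with r hr
  exact_mod_cast div_nonneg posLog_nonneg (log_nonneg hr)

theorem eventually_characteristic_le_rpow {f : ℂ → ℂ} (h : nevanlinnaOrder f < (p : EReal)) :
    ∀ᶠ r in atTop, characteristic f ⊤ r ≤ r ^ p := by
  filter_upwards [eventually_lt_of_limsup_lt h, eventually_gt_atTop 1] with r hr hr1
  have hlog : log⁺ (characteristic f ⊤ r) < p * log r := by
    rw [← div_lt_iff₀ (log_pos hr1)]
    exact_mod_cast hr
  rcases le_or_gt (characteristic f ⊤ r) 0 with h0 | h0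
  · exact h0.trans (rpow_nonneg (by linarith) _)
  · rw [← log_le_log_iff h0 (rpow_pos_of_pos (by linarith) _), log_rpow (by linarith)]
    exact (le_max_right _ _).trans hlog.le

theorem divisor_univ_ne_zero_iff (hg : Meromorphic g) (hfin : ∀ z, meromorphicOrderAt g z ≠ ⊤)
    (a : ℂ) : divisor g univ a ≠ 0 ↔ meromorphicOrderAt g a ≠ 0 := by
  simp [hg.meromorphicOn.divisor_apply (mem_univ a), hfin a]

theorem exists_sphere_meromorphicOrderAt_eq_zero (hg : Meromorphic g)
    (hfin : ∀ z, meromorphicOrderAt g z ≠ ⊤) {x y : ℝ} (hxy : x < y) :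
    ∃ ρ ∈ Ioo x y, ∀ a ∈ sphere 0 ρ, meromorphicOrderAt g a = 0 := by
  have hcount : (norm '' (divisor g univ).support).Countable :=
    countable_support_locallyFinsupp.image _
  obtain ⟨ρ, hρ, hρxy⟩ := (hcount.dense_compl ℝ).exists_between hxy
  refine ⟨ρ, hρxy, fun a ha => ?_⟩
  by_contra h
  exact hρ ⟨a, (divisor_univ_ne_zero_iff hg hfin a).2 h, mem_sphere_zero_iff_norm.1 ha⟩

end Nevanlinna

section LocalComparison

variable {g : ℂ → ℂ} {z w : ℂ} {Q ρ C p : ℝ}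

theorem sum_mul_inv_le_of_radialPotential_le {D : Function.locallyFinsupp ℂ ℤ} {r c : ℝ}
    (hc : 0 ≤ c) (h : radialPotential (divisorMeasure D) r ≤ ENNReal.ofReal c) (S : Finset ℂ) :
    ∑ a ∈ S, |(D a : ℝ)| * (1 + |r - ‖a‖|)⁻¹ ≤ c :=
  (ENNReal.ofReal_le_ofReal_iff hc).1 <|
    (ofReal_sum_mul_le_lintegral_divisorMeasure S fun _ => by positivity).trans h

theorem half_le_abs_sub_norm_of_radialPotential_le {D : Function.locallyFinsupp ℂ ℤ} {r : ℝ}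
    {a : ℂ} (hQ : 2 ≤ Q) (h : radialPotential (divisorMeasure D) r ≤ ENNReal.ofReal Q⁻¹)
    (ha : D a ≠ 0) : Q / 2 ≤ |r - ‖a‖| := by
  have hmass : |(D a : ℝ)| * (1 + |r - ‖a‖|)⁻¹ ≤ Q⁻¹ := by
    simpa only [Finset.sum_singleton] using
      sum_mul_inv_le_of_radialPotential_le (by positivity) h {a}
  have hone : (1 : ℝ) ≤ |(D a : ℝ)| := by exact_mod_cast Int.one_le_abs ha
  have hinv : (1 + |r - ‖a‖|)⁻¹ ≤ Q⁻¹ :=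
    (le_mul_of_one_le_left (by positivity) hone).trans hmass
  linarith [(inv_le_inv₀ (by positivity) (by positivity)).1 hinv]

theorem meromorphicOrderAt_eq_zero_of_radialPotential_le (hg : Meromorphic g)
    (hfin : ∀ z, meromorphicOrderAt g z ≠ ⊤) (hQ : 2 ≤ Q)
    (h : radialPotential (divisorMeasure (divisor g univ)) ‖z‖ ≤ ENNReal.ofReal Q⁻¹)
    (hwz : ‖w - z‖ ≤ Q / 4) : meromorphicOrderAt g w = 0 := by
  by_contra hw
  have hsep := half_le_abs_sub_norm_of_radialPotential_le hQ h
    ((divisor_univ_ne_zero_iff hg hfin w).2 hw)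
  linarith [norm_sub_rev w z, abs_norm_sub_norm_le z w]

theorem sum_abs_divisor_mul_le (hg : Meromorphic g) {S : Finset ℂ}
    (hS : ∀ a ∈ S, 1 ≤ |‖z‖ - ‖a‖|) (hρ : 0 ≤ ρ) :
    ∑ a ∈ S, |(divisor g (ball 0 ρ) a : ℝ)| * (4 * ‖w - z‖ / ρ + 2 * ‖w - z‖ / ‖z - a‖)
      ≤ 4 * ‖w - z‖ / ρ * ∑ a ∈ S, |(divisor g univ a : ℝ)|
        + 4 * ‖w - z‖ * ∑ a ∈ S, |(divisor g univ a : ℝ)| * (1 + |‖z‖ - ‖a‖|)⁻¹ := by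
  rw [Finset.mul_sum, Finset.mul_sum, ← Finset.sum_add_distrib]
  refine Finset.sum_le_sum fun a ha => ?_
  have hdiv : |(divisor g (ball 0 ρ) a : ℝ)| ≤ |(divisor g univ a : ℝ)| := by
    by_cases hab : a ∈ ball 0 ρ
    · rw [hg.meromorphicOn.divisor_apply hab, hg.meromorphicOn.divisor_apply (mem_univ a)]
    · rw [Function.locallyFinsuppWithin.apply_eq_zero_of_notMem _ hab, Int.cast_zero, abs_zero]
      exact abs_nonneg _
  have hinv : 2 * ‖w - z‖ / ‖z - a‖ ≤ 4 * ‖w - z‖ * (1 + |‖z‖ - ‖a‖|)⁻¹ := by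
    have hza : (1 + |‖z‖ - ‖a‖|) / 2 ≤ ‖z - a‖ := by
      linarith [hS a ha, abs_norm_sub_norm_le z a]
    calc 2 * ‖w - z‖ / ‖z - a‖ ≤ 2 * ‖w - z‖ / ((1 + |‖z‖ - ‖a‖|) / 2) := by gcongr
      _ = 4 * ‖w - z‖ * (1 + |‖z‖ - ‖a‖|)⁻¹ := by
        field_simp
        ring
  calc _ ≤ |(divisor g univ a : ℝ)|
        * (4 * ‖w - z‖ / ρ + 4 * ‖w - z‖ * (1 + |‖z‖ - ‖a‖|)⁻¹) := by gcongr
    _ = _ := by ring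

theorem abs_log_norm_sub_le_of_radialPotential_le (hg : MeromorphicNFOn g univ)
    (hfin : ∀ z, meromorphicOrderAt g z ≠ ⊤) (hQ : 2 ≤ Q) (hQz : Q ≤ ‖z‖)
    (h : radialPotential (divisorMeasure (divisor g univ)) ‖z‖ ≤ ENNReal.ofReal Q⁻¹)
    (hwz : ‖w - z‖ ≤ Q / 4) (hρ : 3 * ‖z‖ ≤ ρ)
    (hsphere : ∀ a ∈ sphere 0 ρ, meromorphicOrderAt g a = 0) :
    |log ‖g w‖ - log ‖g z‖| ≤ 8 * ‖w - z‖ / ρ * (characteristic g ⊤ ρ + characteristic g⁻¹ ⊤ ρ)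
      + 4 * ‖w - z‖ / ρ * ((characteristic g ⊤ (2 * ρ) + characteristic g⁻¹ ⊤ (2 * ρ)) / log 2)
      + 1 := by
  have hm : Meromorphic g := fun x => (hg (mem_univ x)).meromorphicAt
  have hfinite : (divisor g (ball 0 ρ)).support.Finite :=
    divisor_ball_support_finite hm.meromorphicOn
  have hsep : ∀ a ∈ (divisor g (ball 0 ρ)).support, Q / 2 ≤ |‖z‖ - ‖a‖| := by
    intro a ha
    refine half_le_abs_sub_norm_of_radialPotential_le hQ h ?_
    have hab : a ∈ ball 0 ρ := (divisor g (ball 0 ρ)).supportWithinDomain ha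
    rwa [hm.meromorphicOn.divisor_apply (mem_univ a), ← hm.meromorphicOn.divisor_apply hab]
  have hmem {a : ℂ} (ha : a ∈ hfinite.toFinset) : a ∈ (divisor g (ball 0 ρ)).support :=
    hfinite.mem_toFinset.1 ha
  have hpotential := sum_mul_inv_le_of_radialPotential_le (by positivity) h hfinite.toFinset
  have hcount := sum_abs_divisor_mul_log_two_le (g := g) (r := ρ) (by linarith)
    (S := hfinite.toFinset) fun a ha => (mem_ball_zero_iff.1
      ((divisor g (ball 0 ρ)).supportWithinDomain (hmem ha))).le
  rw [← le_div_iff₀ (log_pos one_lt_two)] at hcount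
  have hzero {v : ℂ} (hv : ‖v - z‖ ≤ Q / 4) : meromorphicOrderAt g v = 0 :=
    meromorphicOrderAt_eq_zero_of_radialPotential_le hm hfin hQ h hv
  have hw : ‖w‖ ≤ ρ / 2 := by linarith [norm_sub_norm_le w z]
  have hlocal := abs_log_norm_sub_le_proximity_add_sum (z := z) (S := hfinite.toFinset)
    (fun x _ => hg (mem_univ x)) (by linarith) (fun a _ => hfin a) hsphere (by linarith) hw
    (by linarith) (hzero (by simp; linarith)) (hzero hwz)
    (fun a ha => by linarith [hsep a ha, abs_norm_sub_norm_le z a]) hfinite.coe_toFinset.ge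
  have hsum := sum_abs_divisor_mul_le (w := w) hm
    (fun a ha => by linarith [hsep a (hmem ha)]) (by linarith : 0 ≤ ρ)
  refine hlocal.trans <| (add_le_add_right hsum _).trans ?_
  rw [← add_assoc]
  have : 0 ≤ ρ := by linarith
  gcongr ?_ * ?_ + ?_ * ?_ + ?_
  · exact proximity_add_proximity_inv_le (by linarith)
  · calc _ ≤ 4 * (Q / 4) * Q⁻¹ := by gcongr
      _ = 1 := by field_simp

theorem abs_log_norm_sub_le_of_characteristic_le (hg : MeromorphicNFOn g univ)
    (hfin : ∀ z, meromorphicOrderAt g z ≠ ⊤) (hp1 : p ≤ 1) (hC0 : 0 ≤ C)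
    (hC : ∀ r, 1 ≤ r → characteristic g ⊤ r + characteristic g⁻¹ ⊤ r ≤ C * r ^ p)
    (hQ : 2 ≤ Q) (hQz : Q ≤ ‖z‖) (hQp : Q * ‖z‖ ^ p ≤ ‖z‖)
    (h : radialPotential (divisorMeasure (divisor g univ)) ‖z‖ ≤ ENNReal.ofReal Q⁻¹)
    (hwz : ‖w - z‖ ≤ Q / 4) :
    |log ‖g w‖ - log ‖g z‖| ≤ 2 * C + C * 2 ^ p / log 2 + 1 := by
  obtain ⟨ρ, ⟨hzρ, -⟩, hsphere⟩ := exists_sphere_meromorphicOrderAt_eq_zero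
    (fun x => (hg (mem_univ x)).meromorphicAt) hfin (show 3 * ‖z‖ < 4 * ‖z‖ by linarith)
  have hz : 0 < ‖z‖ := by linarith
  have hρ : 0 < ρ := by linarith
  have : 0 < log 2 := log_pos one_lt_two
  have hsmall : ‖w - z‖ / ρ * ρ ^ p ≤ 1 / 4 := by
    calc ‖w - z‖ / ρ * ρ ^ p = ‖w - z‖ * ρ ^ (p - 1) := by
          rw [rpow_sub_one hρ.ne']
          ring
      _ ≤ Q / 4 * ‖z‖ ^ (p - 1) := by
          gcongr ?_ * ?_
          exact rpow_le_rpow_of_nonpos hz (by linarith) (by linarith)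
      _ = Q * ‖z‖ ^ p / ‖z‖ / 4 := by
          rw [rpow_sub_one hz.ne']
          ring
      _ ≤ 1 / 4 := by
          gcongr
          exact (div_le_one hz).2 hQp
  calc |log ‖g w‖ - log ‖g z‖|
      ≤ 8 * ‖w - z‖ / ρ * (characteristic g ⊤ ρ + characteristic g⁻¹ ⊤ ρ)
        + 4 * ‖w - z‖ / ρ * ((characteristic g ⊤ (2 * ρ) + characteristic g⁻¹ ⊤ (2 * ρ)) / log 2)
        + 1 := abs_log_norm_sub_le_of_radialPotential_le hg hfin hQ hQz h hwz hzρ.le hsphere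
    _ ≤ 8 * ‖w - z‖ / ρ * (C * ρ ^ p) + 4 * ‖w - z‖ / ρ * (C * (2 * ρ) ^ p / log 2) + 1 := by
        gcongr
        exacts [hC ρ (by linarith), hC (2 * ρ) (by linarith)]
    _ = (8 * C + 4 * (C * 2 ^ p / log 2)) * (‖w - z‖ / ρ * ρ ^ p) + 1 := by
        rw [mul_rpow two_pos.le hρ.le]
        ring
    _ ≤ (8 * C + 4 * (C * 2 ^ p / log 2)) * (1 / 4) + 1 := by gcongr
    _ = 2 * C + C * 2 ^ p / log 2 + 1 := by ring

theorem exists_hasFiniteLogMeasure_norm_le_mul_norm (hg : MeromorphicNFOn g univ)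
    (hfin : ∀ z, meromorphicOrderAt g z ≠ ⊤) {s : ℝ} (hp : 0 ≤ p) (hps : p < s) (hs : s < 1)
    (hT : ∀ᶠ r in atTop, characteristic g ⊤ r ≤ r ^ p) :
    ∃ E ⊆ Ioi (1 : ℝ), HasFiniteLogMeasure E ∧ ∃ M, ∀ᶠ r in atTop, r ∉ E →
      ∀ z ∈ sphere (0 : ℂ) r, ∀ w ∈ closedBall z (r ^ (1 - s) / 4),
        meromorphicOrderAt g w = 0 ∧ ‖g w‖ ≤ M * ‖g z‖ := by
  have hm : Meromorphic g := fun x => (hg (mem_univ x)).meromorphicAt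
  obtain ⟨C, hC0, hC⟩ := exists_characteristic_add_characteristic_inv_le hm hp hT
  obtain ⟨E, hE1, hE, hpotential⟩ := exists_hasFiniteLogMeasure_radialPotential_le
    (fun r hr => divisorMeasure_closedBall_le hC hr) hp hps hs.le
  refine ⟨E, hE1, hE, exp (2 * C + C * 2 ^ p / log 2 + 1), ?_⟩
  filter_upwards [(tendsto_rpow_atTop (sub_pos.2 hs)).eventually_ge_atTop 2,
    eventually_gt_atTop 1] with r hQ hr hrE z hz w hw
  obtain rfl : ‖z‖ = r := mem_sphere_zero_iff_norm.1 hz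
  rw [mem_closedBall_iff_norm] at hw
  have hz0 : 0 < ‖z‖ := by linarith
  have h : radialPotential (divisorMeasure (divisor g univ)) ‖z‖
      ≤ ENNReal.ofReal (‖z‖ ^ (1 - s))⁻¹ := by
    rw [← rpow_neg hz0.le, neg_sub]
    exact hpotential _ hr hrE
  have hle_self {x : ℝ} (hx : x ≤ 1) : ‖z‖ ^ x ≤ ‖z‖ := rpow_le_self_of_one_le hr.le hx
  have hQp : ‖z‖ ^ (1 - s) * ‖z‖ ^ p ≤ ‖z‖ := by
    rw [← rpow_add hz0]
    exact hle_self (by linarith)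
  have horder {v : ℂ} (hv : ‖v - z‖ ≤ ‖z‖ ^ (1 - s) / 4) : meromorphicOrderAt g v = 0 :=
    meromorphicOrderAt_eq_zero_of_radialPotential_le hm hfin hQ h hv
  have hpos {v : ℂ} (hv : ‖v - z‖ ≤ ‖z‖ ^ (1 - s) / 4) : 0 < ‖g v‖ :=
    norm_pos_iff.2 ((hg (mem_univ v)).meromorphicOrderAt_eq_zero_iff.1 (horder hv))
  have hgz : 0 < ‖g z‖ := hpos (by rw [sub_self, norm_zero]; positivity)
  have hlog := abs_log_norm_sub_le_of_characteristic_le hg hfin (hps.le.trans hs.le) hC0 hC hQ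
    (hle_self (by linarith)) hQp h hw
  refine ⟨horder hw, (log_le_log_iff (hpos hw) (by positivity)).1 ?_⟩
  rw [log_mul (exp_pos _).ne' hgz.ne', log_exp]
  linarith [le_abs_self (log ‖g w‖ - log ‖g z‖)]

end LocalComparison

section FwdDiff

theorem iteratedDeriv_fwdDiff {𝕜 E : Type*} [RCLike 𝕜] [NormedAddCommGroup E] [NormedSpace 𝕜 E]
    {g : 𝕜 → E} {η w : 𝕜} {k : ℕ} (hw : ContDiffAt 𝕜 k g w) (hwη : ContDiffAt 𝕜 k g (w + η)) :
    iteratedDeriv k (fwdDiff η g) w = iteratedDeriv k g (w + η) - iteratedDeriv k g w := by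
  have hshift : ContDiffAt 𝕜 k (fun x => g (x + η)) w :=
    hwη.comp w (f := fun x => x + η) (by fun_prop)
  rw [← congr_fun (iteratedDeriv_comp_add_const k g η) w]
  exact iteratedDeriv_fun_sub hshift hw

theorem analyticAt_iteratedDeriv {𝕜 E : Type*} [NontriviallyNormedField 𝕜]
    [NormedAddCommGroup E] [NormedSpace 𝕜 E] [CompleteSpace E] {g : 𝕜 → E} {x : 𝕜}
    (hg : AnalyticAt 𝕜 g x) (k : ℕ) : AnalyticAt 𝕜 (iteratedDeriv k g) x := by
  rw [iteratedDeriv_eq_iterate]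
  exact hg.iterated_deriv k

theorem norm_fwdDiff_iter_sub_smul_le {𝕜 E : Type*} [RCLike 𝕜]
    [NormedAddCommGroup E] [NormedSpace 𝕜 E] [CompleteSpace E] {g : 𝕜 → E} {s : Set 𝕜}
    (hg : AnalyticOnNhd 𝕜 g s) (hs : Convex ℝ s) {η z : 𝕜} {k : ℕ}
    (hz : ∀ j ≤ k, z + j * η ∈ s) {c : E} {B : ℝ}
    (hB : ∀ w ∈ s, ‖iteratedDeriv k g w - c‖ ≤ B) :
    ‖(fwdDiff η)^[k] g z - η ^ k • c‖ ≤ ‖η‖ ^ k * B := by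
  -- Pass from `g` on `s` to `Δg` on `s ∩ (s - η)`, with `c` replaced by `η • c`.
  induction k generalizing g s c B with
  | zero => simpa using hB z (by simpa using hz 0 le_rfl)
  | succ k ih =>
    have hmvt : ∀ w ∈ s ∩ (fun w => w + η) ⁻¹' s,
        ‖iteratedDeriv k (fwdDiff η g) w - η • c‖ ≤ ‖η‖ * B := by
      rintro w ⟨hw, hwη⟩
      have hderiv : ∀ x ∈ s, HasDerivWithinAt (fun x => iteratedDeriv k g x - x • c)
          (iteratedDeriv (k + 1) g x - c) s x := fun x hx => by
        have h₁ := (analyticAt_iteratedDeriv (hg x hx) k).differentiableAt.hasDerivAt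
        rw [← iteratedDeriv_succ] at h₁
        simpa only [one_smul] using
          (h₁.fun_sub ((hasDerivAt_id' x).smul_const c)).hasDerivWithinAt
      have := hs.norm_image_sub_le_of_norm_hasDerivWithin_le hderiv hB hw hwη
      rw [iteratedDeriv_fwdDiff (hg w hw).contDiffAt (hg _ hwη).contDiffAt, mul_comm]
      convert this using 2
      · rw [add_smul]
        abel
      · rw [add_sub_cancel_left]
    have hΔ : AnalyticOnNhd 𝕜 (fwdDiff η g) (s ∩ (fun w => w + η) ⁻¹' s) := fun w hw =>
      ((hg (w + η) hw.2).fun_comp (f := fun x => x + η) (by fun_prop)).fun_sub (hg w hw.1)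
    have hstep := ih hΔ (hs.inter (hs.translate_preimage_left η))
      (fun j hj => ⟨hz j (by lia), by
        have := hz (j + 1) (by lia)
        push_cast at this
        simpa [add_mul, add_assoc] using this⟩) hmvt
    rw [Function.iterate_succ_apply, pow_succ, pow_succ, mul_assoc, mul_smul]
    exact hstep

theorem norm_fwdDiff_iter_sub_pow_smul_iteratedDeriv_le {E : Type*} [NormedAddCommGroup E]
    [NormedSpace ℂ E] [CompleteSpace E] {g : ℂ → E} {z η : ℂ} {R M : ℝ} {k : ℕ} (hR : 0 < R)
    (hg : AnalyticOnNhd ℂ g (closedBall z R)) (hM : ∀ w ∈ closedBall z R, ‖g w‖ ≤ M)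
    (hk : k * ‖η‖ ≤ R / 2) :
    ‖(fwdDiff η)^[k] g z - η ^ k • iteratedDeriv k g z‖
      ≤ k * (k + 1).factorial * M * (2 * ‖η‖ / R) ^ (k + 1) := by
  set s := closedBall z (k * ‖η‖)
  have hsR : s ⊆ closedBall z R := closedBall_subset_closedBall (by linarith)
  have hzs : z ∈ s := mem_closedBall_self (by positivity)
  have cauchy : ∀ w ∈ s, ‖iteratedDeriv (k + 1) g w‖
      ≤ (k + 1).factorial * M / (R / 2) ^ (k + 1) := by
    intro w hw
    have hball : closedBall w (R / 2) ⊆ closedBall z R :=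
      closedBall_subset_closedBall' (by linarith [mem_closedBall.1 hw])
    refine Complex.norm_iteratedDeriv_le_of_forall_mem_sphere_norm_le _ (by positivity) ?_
      fun v hv => hM v (hball (sphere_subset_closedBall hv))
    exact ((hg.mono hball).differentiableOn.mono closure_ball_subset_closedBall).diffContOnCl
  have lipschitz : ∀ w ∈ s, ‖iteratedDeriv k g w - iteratedDeriv k g z‖
      ≤ (k + 1).factorial * M / (R / 2) ^ (k + 1) * (k * ‖η‖) := by
    intro w hw
    have hM0 : 0 ≤ M := (norm_nonneg _).trans (hM z (hsR hzs))
    refine ((convex_closedBall z _).norm_image_sub_le_of_norm_deriv_le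
      (C := (k + 1).factorial * M / (R / 2) ^ (k + 1))
      (fun x hx => (analyticAt_iteratedDeriv (hg x (hsR hx)) k).differentiableAt)
      (fun x hx => ?_) hzs hw).trans ?_
    · rw [← iteratedDeriv_succ]
      exact cauchy x hx
    · gcongr
      exact mem_closedBall_iff_norm.1 hw
  refine (norm_fwdDiff_iter_sub_smul_le (hg.mono hsR) (convex_closedBall z _)
    (fun j hj => ?_) lipschitz).trans_eq ?_
  · rw [mem_closedBall_iff_norm, add_sub_cancel_left, norm_mul, RCLike.norm_natCast]
    gcongr
  · rw [div_pow, div_pow, mul_pow]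
    field_simp
    ring

end FwdDiff

section Conclusion

variable {f g : ℂ → ℂ} {p s : ℝ} {z : ℂ}

theorem HasFiniteLogMeasure.union {E F : Set ℝ} (hE : HasFiniteLogMeasure E)
    (hF : HasFiniteLogMeasure F) : HasFiniteLogMeasure (E ∪ F) :=
  ⟨hE.1.union hF.1, (lintegral_union_le _ _ _).trans_lt (ENNReal.add_lt_top.2 ⟨hE.2, hF.2⟩)⟩

theorem hasFiniteLogMeasure_of_countable {E : Set ℝ} (hE : E.Countable) :
    HasFiniteLogMeasure E :=
  ⟨hE.measurableSet, by
    rw [setLIntegral_measure_zero _ _ (hE.measure_zero volume)]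
    exact ENNReal.zero_lt_top⟩

theorem hasFiniteLogMeasure_Ioc_one (b : ℝ) : HasFiniteLogMeasure (Ioc 1 b) := by
  refine ⟨measurableSet_Ioc, ?_⟩
  calc ∫⁻ t in Ioc 1 b, ENNReal.ofReal (1 / t) ≤ ∫⁻ _ in Ioc 1 b, 1 := by
        refine setLIntegral_mono' measurableSet_Ioc fun t ht => ?_
        exact ENNReal.ofReal_le_one.2 ((div_le_one (one_pos.trans ht.1)).2 ht.1.le)
    _ < ⊤ := by simp

theorem HasFiniteLogMeasure.exists_forall_of_eventually {E : Set ℝ} {P : ℝ → Prop}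
    (hE : HasFiniteLogMeasure E) (hE1 : E ⊆ Ioi 1) (hP : ∀ᶠ r in atTop, r ∉ E → P r) :
    ∃ F ⊆ Ioi (1 : ℝ), HasFiniteLogMeasure F ∧ ∀ r, 1 < r → r ∉ F → P r := by
  obtain ⟨r₀, hr₀⟩ := eventually_atTop.1 hP
  refine ⟨E ∪ Ioc 1 r₀, union_subset hE1 fun r hr => hr.1,
    hE.union (hasFiniteLogMeasure_Ioc_one r₀), fun r hr hrF => ?_⟩
  rw [mem_union, not_or, mem_Ioc, not_and, not_le] at hrF
  exact hr₀ r (hrF.2 hr).le hrF.1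

theorem exists_hasFiniteLogMeasure_forall_analyticAt_add_mul (hf : Meromorphic f) (η : ℂ) :
    ∃ E ⊆ Ioi (1 : ℝ), HasFiniteLogMeasure E ∧
      ∀ z, 1 < ‖z‖ → ‖z‖ ∉ E → ∀ j : ℕ, AnalyticAt ℂ f (z + j * η) := by
  set B : Set ℝ := ⋃ j : ℕ, (fun b => ‖b - j * η‖) '' {b | AnalyticAt ℂ f b}ᶜ
  have hB : B.Countable := by
    refine countable_iUnion fun j => Countable.image ?_ _
    simpa only [inter_univ] using
      (hf.meromorphicOn (s := univ)).countable_compl_analyticAt_inter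
  refine ⟨B ∩ Ioi 1, inter_subset_right,
    hasFiniteLogMeasure_of_countable (hB.mono inter_subset_left), fun z hz hzB j => ?_⟩
  by_contra hj
  exact hzB ⟨mem_iUnion.2 ⟨j, z + j * η, hj, by simp⟩, hz⟩

theorem toMeromorphicNFOn_univ_apply (hf : Meromorphic f) (hz : AnalyticAt ℂ f z) :
    toMeromorphicNFOn f univ z = f z := by
  rw [toMeromorphicNFOn_eq_toMeromorphicNFAt hf.meromorphicOn (mem_univ z),
    toMeromorphicNFAt_eq_self.2 hz.meromorphicNFAt]

theorem toMeromorphicNFOn_univ_eventuallyEq (hf : Meromorphic f) (hz : AnalyticAt ℂ f z) :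
    toMeromorphicNFOn f univ =ᶠ[𝓝 z] f :=
  hz.eventually_analyticAt.mono fun _ => toMeromorphicNFOn_univ_apply hf

theorem meromorphicOrderAt_ne_top_of_not_eventuallyEq_zero (hf : Meromorphic f)
    (hf0 : ¬ f =ᶠ[codiscrete ℂ] 0) (z : ℂ) : meromorphicOrderAt f z ≠ ⊤ := by
  intro hz
  have hfU : MeromorphicOn f univ := hf.meromorphicOn
  have htop : ∀ u, meromorphicOrderAt f u = ⊤ := by
    by_contra! h
    obtain ⟨u, hu⟩ := h
    exact (hfU.exists_meromorphicOrderAt_ne_top_iff_forall isConnected_univ).1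
      ⟨⟨u, mem_univ u⟩, hu⟩ ⟨z, mem_univ z⟩ hz
  refine hf0 ?_
  filter_upwards [hfU.analyticAt_mem_codiscreteWithin] with u hu
  have hzero := meromorphicOrderAt_eq_top_iff.1 (htop u)
  exact (hu.frequently_zero_iff_eventually_zero.1 hzero.frequently).self_of_nhds

theorem exists_norm_fwdDiff_div_sub_le_of_meromorphicNFOn (hg : MeromorphicNFOn g univ)
    (hfin : ∀ z, meromorphicOrderAt g z ≠ ⊤) (hp : 0 ≤ p) (hps : p < s) (hs : s < 1)
    (hT : ∀ᶠ r in atTop, characteristic g ⊤ r ≤ r ^ p) (η : ℂ) (k : ℕ) :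
    ∃ E ⊆ Ioi (1 : ℝ), HasFiniteLogMeasure E ∧ ∃ C, ∀ᶠ r in atTop, r ∉ E →
      ∀ z ∈ sphere (0 : ℂ) r, g z ≠ 0 ∧
        ‖(fwdDiff η)^[k] g z / g z - η ^ k * (iteratedDeriv k g z / g z)‖
          ≤ C * r ^ ((k + 1) * (s - 1)) := by
  obtain ⟨E, hE1, hE, M, hM⟩ :=
    exists_hasFiniteLogMeasure_norm_le_mul_norm hg hfin hp hps hs hT
  refine ⟨E, hE1, hE, k * (k + 1).factorial * M * (8 * ‖η‖) ^ (k + 1), ?_⟩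
  filter_upwards [hM, eventually_gt_atTop 0,
    (tendsto_rpow_atTop (sub_pos.2 hs)).eventually_ge_atTop (8 * (k * ‖η‖))]
    with r hr hr0 hrk hrE z hz
  set R := r ^ (1 - s) / 4 with hRdef
  have hR : 0 < R := by positivity
  have hdisc := hr hrE z hz
  have hgz : g z ≠ 0 := (hg (mem_univ z)).meromorphicOrderAt_eq_zero_iff.1
    (hdisc z (mem_closedBall_self hR.le)).1
  have hana : AnalyticOnNhd ℂ g (closedBall z R) := fun w hw =>
    (hg (mem_univ w)).meromorphicOrderAt_nonneg_iff_analyticAt.1 (hdisc w hw).1.ge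
  have hpow : (2 * ‖η‖ / R) ^ (k + 1) = (8 * ‖η‖) ^ (k + 1) * r ^ ((k + 1) * (s - 1)) := by
    have hbase : 2 * ‖η‖ / R = 8 * ‖η‖ * r ^ (s - 1) := by
      rw [hRdef, ← neg_sub s 1, rpow_neg hr0.le]
      field_simp
      ring
    rw [hbase, mul_pow, ← rpow_mul_natCast hr0.le]
    push_cast
    rw [mul_comm (s - 1)]
  refine ⟨hgz, ?_⟩
  rw [← mul_div_assoc, ← sub_div, norm_div, div_le_iff₀ (norm_pos_iff.2 hgz)]
  calc ‖(fwdDiff η)^[k] g z - η ^ k * iteratedDeriv k g z‖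
      ≤ k * (k + 1).factorial * (M * ‖g z‖) * (2 * ‖η‖ / R) ^ (k + 1) :=
        norm_fwdDiff_iter_sub_pow_smul_iteratedDeriv_le hR hana (fun w hw => (hdisc w hw).2)
          (by linarith)
    _ = _ := by
        rw [hpow]
        ring

theorem exists_norm_fwdDiff_div_sub_le_of_characteristic_le (hf : Meromorphic f)
    (hf0 : ¬ f =ᶠ[codiscrete ℂ] 0) (hp : 0 ≤ p) (hps : p < s) (hs : s < 1)
    (hT : ∀ᶠ r in atTop, characteristic f ⊤ r ≤ r ^ p) (η : ℂ) (k : ℕ) :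
    ∃ E ⊆ Ioi (1 : ℝ), HasFiniteLogMeasure E ∧ ∃ C, ∀ z, 1 < ‖z‖ → ‖z‖ ∉ E →
      f z ≠ 0 ∧ (∀ j : ℕ, AnalyticAt ℂ f (z + j * η)) ∧
        ‖(fwdDiff η)^[k] f z / f z - η ^ k * (iteratedDeriv k f z / f z)‖
          ≤ C * ‖z‖ ^ ((k + 1) * (s - 1)) := by
  set g := toMeromorphicNFOn f univ
  have hfin : ∀ z, meromorphicOrderAt g z ≠ ⊤ := fun z => by
    rw [meromorphicOrderAt_toMeromorphicNFOn hf.meromorphicOn (mem_univ z)]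
    exact meromorphicOrderAt_ne_top_of_not_eventuallyEq_zero hf hf0 z
  have hTg : ∀ᶠ r in atTop, characteristic g ⊤ r ≤ r ^ p := by
    filter_upwards [hT, eventually_ne_atTop 0] with r hr hr0
    rwa [← characteristic_congr_codiscrete (toMeromorphicNFOn_eqOn_codiscrete hf.meromorphicOn)
      hr0]
  obtain ⟨E, hE1, hE, C, hC⟩ := exists_norm_fwdDiff_div_sub_le_of_meromorphicNFOn
    (meromorphicNFOn_toMeromorphicNFOn f univ) hfin hp hps hs hTg η k
  obtain ⟨F, hF1, hF, hFC⟩ := hE.exists_forall_of_eventually hE1 hC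
  obtain ⟨A, hA1, hA, hAf⟩ := exists_hasFiniteLogMeasure_forall_analyticAt_add_mul hf η
  refine ⟨F ∪ A, union_subset hF1 hA1, hF.union hA, C, fun z hz hzFA => ?_⟩
  rw [mem_union, not_or] at hzFA
  have hana := hAf z hz hzFA.2
  have hz0 : AnalyticAt ℂ f z := by simpa using hana 0
  have hdiff : (fwdDiff η)^[k] f z = (fwdDiff η)^[k] g z := by
    simp only [fwdDiff_iter_eq_sum_shift, nsmul_eq_mul]
    exact Finset.sum_congr rfl fun j _ =>
      congrArg _ (toMeromorphicNFOn_univ_apply hf (hana j)).symm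
  rw [hdiff, ← (toMeromorphicNFOn_univ_eventuallyEq hf hz0).iteratedDeriv_eq k,
    ← toMeromorphicNFOn_univ_apply hf hz0]
  obtain ⟨hgz, hest⟩ := hFC ‖z‖ hz hzFA.1 z (mem_sphere_zero_iff_norm.2 rfl)
  exact ⟨hgz, hana, hest⟩

end Conclusion

theorem theorem5p2 (f : ℂ → ℂ) (hf : Meromorphic f)
    (hf0 : ¬ f =ᶠ[Filter.codiscrete ℂ] 0)
    (σ : ℝ) (hσ : nevanlinnaOrder f = (σ : EReal)) (hσ1 : σ < 1)
    (η : ℂ) (hη : η ≠ 0) (ε : ℝ) (hε : 0 < ε) (k : ℕ) :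
    ∃ E : Set ℝ, E ⊆ Set.Ioi 1 ∧ HasFiniteLogMeasure E ∧
      ∃ C : ℝ, ∀ z : ℂ, ‖z‖ ∉ E ∪ Set.Icc 0 1 →
        f z ≠ 0 ∧ (∀ j : ℕ, j ≤ k → AnalyticAt ℂ f (z + j * η)) ∧
        ‖((fwdDiff η)^[k] f) z / f z - η ^ k * (iteratedDeriv k f z / f z)‖
          ≤ C * ‖z‖ ^ (((k : ℝ) + 1) * (σ - 1) + ε) := by
  have hσ0 : 0 ≤ σ := by exact_mod_cast hσ ▸ nevanlinnaOrder_nonneg f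
  obtain ⟨s, hσs, hs⟩ : ∃ s, σ < s ∧ s < min 1 (σ + ε / (k + 1)) :=
    exists_between (lt_min hσ1 (lt_add_of_pos_right σ (by positivity)))
  obtain ⟨hs1, hsε⟩ := lt_min_iff.1 hs
  obtain ⟨p, hσp, hps⟩ := exists_between hσs
  have hT : ∀ᶠ r in atTop, characteristic f ⊤ r ≤ r ^ p :=
    eventually_characteristic_le_rpow (by rw [hσ]; exact_mod_cast hσp)
  have hexp : ((k : ℝ) + 1) * (s - 1) ≤ (k + 1) * (σ - 1) + ε := by
    rw [← sub_lt_iff_lt_add', lt_div_iff₀ (by positivity)] at hsε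
    linarith
  obtain ⟨E, hE1, hE, C, hC⟩ := exists_norm_fwdDiff_div_sub_le_of_characteristic_le hf hf0
    (hσ0.trans hσp.le) hps hs1 hT η k
  refine ⟨E, hE1, hE, |C|, fun z hz => ?_⟩
  obtain ⟨hzE, hz1⟩ : ‖z‖ ∉ E ∧ 1 < ‖z‖ := by simpa [not_or] using hz
  obtain ⟨hfz, hana, hest⟩ := hC z hz1 hzE
  refine ⟨hfz, fun j _ => hana j, hest.trans ?_⟩
  gcongr
  exacts [le_abs_self C, hz1.le]
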